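/- **Theorem (Heisenberg uncertainty inequality for the WVD-QOLCT).** Let $\mathbb H$ be the quaternions with modulus $|\cdot|_Q$ and let $\lambda,\mu\in\mathbb H$ satisfy $\lambda^2=\mu^2=-1$. For $\nu\in\{\lambda,\mu\}$ and $\theta\in\mathbb R$ put $e^{\nu\theta}=\cos\theta+\nu\sin\theta$. For $l=1,2$ let $a_l,b_l,c_l,d_l,\tau_l,\eta_l\in\mathbb R$ with $a_ld_l-b_lc_l=1$, and write $A_l$ for these six parameters. If $b_l\neq 0$, let $$K^{\nu}_{A_l}(x,y)=\frac{1}{\sqrt{\nu 2\pi b_l}}\,\exp\Big(\nu\,\frac{a_lx^2-2x(y-\tau_l)-2y(d_l\tau_l-b_l\eta_l)+d_l(y^2+\tau_l^2)}{2b_l}\Big),\qquad \frac1{\sqrt{\nu 2\pi b_l}}=\frac{e^{-\nu\,\mathrm{sgn}(b_l)\pi/4}}{\sqrt{2\pi|b_l|}} .$$ If $b_l=0$, let $D^{\nu}_{A_l}(y)=\sqrt{d_l}\;e^{\nu\left(\frac{c_ld_l}{2}(y-\tau_l)^2+y\tau_l\right)}$, where $\sqrt{d_l}=\nu\sqrt{-d_l}$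 if $d_l<0$. The two-sided quaternionic offset linear canonical transform (QOLCT) of $h:\mathbb R^2\to\mathbb H$ at $u\in\mathbb R^2$ is $$\mathcal O\{h\}(u)=\begin{cases}\displaystyle\int_{\mathbb R^2}K^\lambda_{A_1}(s_1,u_1)\,h(s)\,K^\mu_{A_2}(s_2,u_2)\,ds, & b_1,b_2\ne0,\\[1ex] \displaystyle\int_{\mathbb R}D^\lambda_{A_1}(u_1)\,h(d_1(u_1-\tau_1),s_2)\,K^\mu_{A_2}(s_2,u_2)\,ds_2, & b_1=0,\ b_2\neq0,\\[1ex] \displaystyle\int_{\mathbb R}K^\lambda_{A_1}(s_1,u_1)\,h(s_1,d_2(u_2-\tau_2))\,D^\mu_{A_2}(u_2)\,ds_1, & b_1\ne0,\ b_2=0,\\[1ex] D^\lambda_{A_1}(u_1)\,h(d_1(u_1-\tau_1),d_2(u_2-\tau_2))\,D^\mu_{A_2}(u_2), & b_1=b_2=0.\end{cases}$$ For a signal $h=h_0+ih_1+jh_2+kh_3$ with real-valued components $h_m$, put $$\|\mathcal O\{h\}(u)\|_Q=\Big(\sum_{m=0}^{3}|\mathcal O\{h_m\}(u)|_Q^2\Big)^{1/2}.$$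 For $f,g:\mathbb R^2\to\mathbb H$ and $t,s\in\mathbb R^2$ put $h_{f,g}(t,s)=f(t+\tfrac s2)\,\overline{g(t-\tfrac s2)}$. The Wigner-Ville distribution of $f,g$ associated with the QOLCT (WVD-QOLCT) is $\mathcal W_{f,g}(t,\xi)=\mathcal O\{h_{f,g}(t,\cdot)\}(\xi)$, and accordingly $$\Big\|\frac{\xi_k}{2\pi b_k}\mathcal W_{f,g}(t,\xi)\Big\|_Q=\Big|\frac{\xi_k}{2\pi b_k}\Big|\,\big\|\mathcal O\{h_{f,g}(t,\cdot)\}(\xi)\big\|_Q .$$ Finally, $|f|_{2,Q}=\big(\int_{\mathbb R^2}|f(t)|_Q^2\,dt\big)^{1/2}$. Then for all quaternion-valued Schwartz functions $f,g\in\mathcal S(\mathbb R^2,\mathbb H)$ and each $k\in\{1,2\}$ with $b_k\neq0$, $$\left(\int_{\mathbb R^2}\int_{\mathbb R^2}\big|s_k\,f(t+\tfrac s2)\,\overline{g(t-\tfrac s2)}\big|_Q^2\,ds\,dt\right)\left(\int_{\mathbb R^2}\int_{\mathbb R^2}\Big\|\frac{\xi_k}{2\pi b_k}\mathcal W_{f,g}(t,\xi)\Big\|_Q^2\,d\xi\,dt\right)\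 \ge\ \frac{1}{16\pi^2}\,|f|_{2,Q}^4\,|g|_{2,Q}^4 .$$ -/

import Mathlib

open MeasureTheory
open scoped Quaternion SchwartzMap

namespace QOLCT

noncomputable section

/-- The real parameters `(a, b, c, d | τ, η)` of a one-dimensional offset linear canonical
transform, with `a d - b c = 1`. -/
structure Params where
  a : ℝ
  b : ℝ
  c : ℝ
  d : ℝ
  τ : ℝ
  η : ℝ
  det_eq_one : a * d - b * c = 1

/-- `ℝ²` with its Euclidean norm and Lebesgue measure. -/
abbrev Plane : Type := EuclideanSpace ℝ (Fin 2)

/-- `e^{ν θ} = cos θ + ν sin θ` for a pure unit quaternion `ν` and a real `θ`. -/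
def unitExp (ν : ℍ[ℝ]) (θ : ℝ) : ℍ[ℝ] :=
  (Real.cos θ : ℍ[ℝ]) + ν * (Real.sin θ : ℍ[ℝ])

/-- The principal value of `1 / √(ν 2 π b)` for real `b ≠ 0`, with
`1 / √ν = e^{-ν π / 4}` and `1 / √(-ν) = e^{ν π / 4}`. -/
def kernelConst (ν : ℍ[ℝ]) (b : ℝ) : ℍ[ℝ] :=
  ((1 / Real.sqrt (2 * Real.pi * |b|) : ℝ) : ℍ[ℝ]) *
    unitExp ν (-(SignType.sign b : ℝ) * (Real.pi / 4))

/-- The kernel `K^ν_A(t, u)`, used when `A.b ≠ 0`. -/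
def kernel (ν : ℍ[ℝ]) (A : Params) (t u : ℝ) : ℍ[ℝ] :=
  kernelConst ν A.b *
    unitExp ν ((A.a * t ^ 2 - 2 * t * (u - A.τ) - 2 * u * (A.d * A.τ - A.b * A.η)
      + A.d * (u ^ 2 + A.τ ^ 2)) * (1 / (2 * A.b)))

/-- The principal square root of the real number `x`, in the complex plane `ℝ + ℝ ν`. -/
def principalSqrt (ν : ℍ[ℝ]) (x : ℝ) : ℍ[ℝ] :=
  if 0 ≤ x then (Real.sqrt x : ℍ[ℝ]) else ν * (Real.sqrt (-x) : ℍ[ℝ])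

/-- The factor `√d e^{ν (c d (u - τ)² / 2 + u τ)}`, which stands in for the kernel when
`A.b = 0`. -/
def degenerateFactor (ν : ℍ[ℝ]) (A : Params) (u : ℝ) : ℍ[ℝ] :=
  principalSqrt ν A.d * unitExp ν (A.c * A.d / 2 * (u - A.τ) ^ 2 + u * A.τ)

/-- The two-sided quaternionic offset linear canonical transform of `h : ℝ² → ℍ` at `u`. In a
variable whose parameter `b` is zero, the integration against the kernel is replaced by evaluation
at `d (u - τ)`. -/
def qolct (lam mu : ℍ[ℝ]) (A : Fin 2 → Params) (h : Plane → ℍ[ℝ]) (u : Plane) : ℍ[ℝ] :=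
  if (A 0).b ≠ 0 then
    if (A 1).b ≠ 0 then
      ∫ s : Plane, kernel lam (A 0) (s 0) (u 0) * h s * kernel mu (A 1) (s 1) (u 1)
    else
      ∫ x : ℝ, kernel lam (A 0) x (u 0) * h !₂[x, (A 1).d * (u 1 - (A 1).τ)]
        * degenerateFactor mu (A 1) (u 1)
  else
    if (A 1).b ≠ 0 then
      ∫ y : ℝ, degenerateFactor lam (A 0) (u 0) * h !₂[(A 0).d * (u 0 - (A 0).τ), y]
        * kernel mu (A 1) y (u 1)
    else
      degenerateFactor lam (A 0) (u 0)
        * h !₂[(A 0).d * (u 0 - (A 0).τ), (A 1).d * (u 1 - (A 1).τ)]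
        * degenerateFactor mu (A 1) (u 1)

/-- The real components `q₀, q₁, q₂, q₃` of `q = q₀ + i q₁ + j q₂ + k q₃`. -/
def component (m : Fin 4) (q : ℍ[ℝ]) : ℝ :=
  ![q.re, q.imI, q.imJ, q.imK] m

/-- For a transform `T` of quaternion-valued signals, the modulus
`‖T{h}(u)‖_Q = √(∑ₘ |T{hₘ}(u)|²)`, where `h = h₀ + i h₁ + j h₂ + k h₃` with real-valued `hₘ`. -/
def transformModulus (T : (Plane → ℍ[ℝ]) → Plane → ℍ[ℝ]) (h : Plane → ℍ[ℝ]) (u : Plane) : ℝ :=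
  Real.sqrt (∑ m : Fin 4, ‖T (fun s => ((component m (h s) : ℝ) : ℍ[ℝ])) u‖ ^ 2)

/-- `h_{f,g}(t, s) = f(t + s/2) \bar g(t - s/2)`. -/
def crossSignal (f g : Plane → ℍ[ℝ]) (t s : Plane) : ℍ[ℝ] :=
  f (t + (1 / 2 : ℝ) • s) * star (g (t - (1 / 2 : ℝ) • s))

/-- The Wigner-Ville distribution `W_{f,g}(t, u)` associated with the two-sided QOLCT: the QOLCT of
`s ↦ f(t + s/2) \bar g(t - s/2)`, evaluated at `u`. -/
def wvd (lam mu : ℍ[ℝ]) (A : Fin 2 → Params) (f g : Plane → ℍ[ℝ]) (t u : Plane) : ℍ[ℝ] :=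
  qolct lam mu A (crossSignal f g t) u

/-- `‖W_{f,g}(t, u)‖_Q`, the modulus of the QOLCT `W_{f,g}(t, ·)` of `h_{f,g}(t, ·)` at `u`. As for
every transform, the modulus `‖·‖_Q` is taken through the real components of the transformed
signal, so it is not the quaternion modulus of the value `wvd lam mu A f g t u`. -/
def wvdModulus (lam mu : ℍ[ℝ]) (A : Fin 2 → Params) (f g : Plane → ℍ[ℝ]) (t u : Plane) : ℝ :=
  transformModulus (qolct lam mu A) (crossSignal f g t) u

/-- `|f|_{2,Q} = (∫ |f(t)|² dt)^{1/2}`. -/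
def l2Norm (f : Plane → ℍ[ℝ]) : ℝ :=
  Real.sqrt (∫ t : Plane, ‖f t‖ ^ 2)

end

end QOLCT

/-!
For a Schwartz function `h` the squared norm of `(ξ_k / (2 π b_k)) ‖𝒪{h}(ξ)‖_Q` is computed exactly.
For a real signal `φ`, split `ℍ` into the two orthogonal planes `{q | q mu = ± lam q}`. On each
of them right multiplication by `e^{mu θ}` is left multiplication by `e^{± lam θ}`, so the two-sided
transform of `φ` becomes a pair of complex Fourier transforms of `φ` multiplied by a quadratic
chirp, with sign `+` or `-` in the second variable. By Plancherel the weight `ξ_k` turns into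
`∂_k`, and since `φ` is real the derivative of the chirp is orthogonal to `∂_k φ`. Hence the answer
`1 / (4 π²) ∫ (|∂_k φ|² + |r φ|²)`, with `r` the derivative of the chirp phase, is the same on both
planes; it is additive over the four components of `h`. If the other variable is degenerate, the
transform is a one-dimensional one after an affine change of that variable, with the same answer.

The function `(t, s) ↦ f(t + s/2) \bar g(t - s/2)` is Schwartz on the product, being `f ⊗ \bar g`
composed with a measure preserving linear map, so the claim is the classical Heisenberg inequality
in the direction `s_k` there, and the term `|r φ|²` is dropped.
-/

namespace QOLCT

open scoped FourierTransform LineDeriv RealInnerProductSpace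

/-- `f` is integrable with Bochner integral `I`. Integrability is kept next to the value because
`∫ x, f x ∂μ` is `0` when `f` is not integrable. -/
def HasBochnerIntegral {α : Type*} [MeasurableSpace α] (f : α → ℝ) (I : ℝ) (μ : Measure α) : Prop :=
  Integrable f μ ∧ ∫ x, f x ∂μ = I

namespace HasBochnerIntegral

section Measure

variable {α β ι : Type*} [MeasurableSpace α] [MeasurableSpace β] {μ : Measure α} {ν : Measure β}

theorem add {f g : α → ℝ} {I J : ℝ} (hf : HasBochnerIntegral f I μ)
    (hg : HasBochnerIntegral g J μ) : HasBochnerIntegral (fun x => f x + g x) (I + J) μ :=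
  ⟨hf.1.add hg.1, by rw [integral_add hf.1 hg.1, hf.2, hg.2]⟩

theorem const_mul {f : α → ℝ} {I : ℝ} (hf : HasBochnerIntegral f I μ) (c : ℝ) :
    HasBochnerIntegral (fun x => c * f x) (c * I) μ :=
  ⟨hf.1.const_mul c, by rw [integral_const_mul, hf.2]⟩

theorem sum {s : Finset ι} {f : ι → α → ℝ} {I : ι → ℝ}
    (hf : ∀ i ∈ s, HasBochnerIntegral (f i) (I i) μ) :
    HasBochnerIntegral (fun x => ∑ i ∈ s, f i x) (∑ i ∈ s, I i) μ :=
  ⟨integrable_finsetSum s fun i hi => (hf i hi).1, by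
    rw [integral_finsetSum s fun i hi => (hf i hi).1]
    exact Finset.sum_congr rfl fun i hi => (hf i hi).2⟩

theorem comp_measurePreserving {f : β → ℝ} {I : ℝ} (hf : HasBochnerIntegral f I ν) {e : α → β}
    (he : MeasurePreserving e μ ν) (hemb : MeasurableEmbedding e) :
    HasBochnerIntegral (fun x => f (e x)) I μ :=
  ⟨(he.integrable_comp_emb hemb).2 hf.1, by rw [he.integral_comp hemb, hf.2]⟩

theorem integral_prod_left [SFinite μ] [SFinite ν] {f : α × β → ℝ} {I : ℝ}
    (hf : HasBochnerIntegral f I (μ.prod ν)) :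
    HasBochnerIntegral (fun x => ∫ y, f (x, y) ∂ν) I μ :=
  ⟨hf.1.integral_prod_left, by rw [← integral_prod f hf.1, hf.2]⟩

theorem prod_of_nonneg [SFinite μ] [SFinite ν] {f : α × β → ℝ} {g : α → ℝ} {I : ℝ}
    (hf : AEStronglyMeasurable f (μ.prod ν)) (hf0 : ∀ p, 0 ≤ f p)
    (hfg : ∀ x, HasBochnerIntegral (fun y => f (x, y)) (g x) ν) (hg : HasBochnerIntegral g I μ) :
    HasBochnerIntegral f I (μ.prod ν) := by
  have hint : Integrable f (μ.prod ν) := by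
    refine (integrable_prod_iff hf).2 ⟨.of_forall fun x => (hfg x).1, ?_⟩
    simpa only [Real.norm_of_nonneg (hf0 _), (hfg _).2] using hg.1
  exact ⟨hint, by simp only [integral_prod f hint, (hfg _).2, hg.2]⟩

end Measure

section ChangeOfVariables

theorem comp_linearMap_add {E : Type*} [NormedAddCommGroup E] [NormedSpace ℝ E]
    [FiniteDimensional ℝ E] [MeasurableSpace E] [BorelSpace E] {μ : Measure E}
    [μ.IsAddHaarMeasure] {G : E → ℝ} {I : ℝ} (hG : HasBochnerIntegral G I μ) (L : E →ₗ[ℝ] E)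
    (hL : LinearMap.det L ≠ 0) (e : E) :
    HasBochnerIntegral (fun x => |LinearMap.det L| * G (L x + e)) I μ := by
  have hmap : μ.map (fun x => L x + e) = ENNReal.ofReal |(LinearMap.det L)⁻¹| • μ := by
    have hcomp : (fun x => L x + e) = (· + e) ∘ L := rfl
    rw [hcomp, ← Measure.map_map (measurable_add_const e)
      L.continuous_of_finiteDimensional.measurable,
      Measure.map_linearMap_addHaar_eq_smul_addHaar μ hL, Measure.map_smul, map_add_right_eq_self]
  have hmeas : Measurable fun x => L x + e :=
    L.continuous_of_finiteDimensional.measurable.add_const e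
  have hG' : Integrable G (μ.map fun x => L x + e) := by
    rw [hmap]
    exact hG.1.smul_measure ENNReal.ofReal_ne_top
  refine ⟨(hG'.comp_measurable hmeas).const_mul _, ?_⟩
  rw [integral_const_mul, ← integral_map hmeas.aemeasurable hG'.aestronglyMeasurable, hmap,
    integral_smul_measure, hG.2, ENNReal.toReal_ofReal (abs_nonneg _), abs_inv, smul_eq_mul,
    mul_inv_cancel_left₀ (abs_ne_zero.2 hL)]

theorem comp_diagonal_add {ι : Type*} [Fintype ι] {G : EuclideanSpace ℝ ι → ℝ} {I : ℝ}
    (hG : HasBochnerIntegral G I volume) {c : ι → ℝ} (hc : ∀ i, c i ≠ 0) (e : ι → ℝ) :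
    HasBochnerIntegral
      (fun ξ : EuclideanSpace ℝ ι => (∏ i, |c i|) * G (WithLp.toLp 2 fun i => c i * ξ i + e i))
      I volume := by
  classical
  have hdet : LinearMap.det (Matrix.toEuclideanLin (Matrix.diagonal c)) = ∏ i, c i := by
    rw [Matrix.toEuclideanLin_eq_toLin_orthonormal, LinearMap.det_toLin, Matrix.det_diagonal]
  convert hG.comp_linearMap_add (Matrix.toEuclideanLin (Matrix.diagonal c))
    (hdet ▸ Finset.prod_ne_zero_iff.2 fun i _ => hc i) (WithLp.toLp 2 e) using 4 with ξ
  · rw [hdet, Finset.abs_prod]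
  · ext i
    simp [Matrix.toLpLin_apply, Matrix.mulVec_diagonal]

end ChangeOfVariables

end HasBochnerIntegral

section Schwartz

variable {D F : Type*} [NormedAddCommGroup D] [NormedSpace ℝ D] [NormedAddCommGroup F]
  [NormedSpace ℝ F]

/-- The integral of `‖∂_v φ‖² + ‖r φ‖²`. For a real-valued `φ` it is the squared `L²` norm of
`∂_v (e^{iQ} φ)`, where `r = ∂_v Q`. -/
noncomputable def chirpEnergy [MeasurableSpace D] (v : D) (r : D → ℝ) (φ : 𝓢(D, F))
    (μ : Measure D) : ℝ :=
  ∫ x, (‖∂_{v} φ x‖ ^ 2 + ‖r x • φ x‖ ^ 2) ∂μ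

variable [FiniteDimensional ℝ D] [MeasurableSpace D] [BorelSpace D]

theorem integrable_norm_sq (φ : 𝓢(D, F)) (μ : Measure D) [μ.IsAddHaarMeasure] :
    Integrable (fun x => ‖φ x‖ ^ 2) μ :=
  (φ.memLp 2 μ).integrable_norm_pow two_ne_zero

theorem integrable_norm_smul_sq (φ : 𝓢(D, F)) {r : D → ℝ} (hr : r.HasTemperateGrowth)
    (μ : Measure D) [μ.IsAddHaarMeasure] : Integrable (fun x => ‖r x • φ x‖ ^ 2) μ := by
  simpa only [SchwartzMap.smulLeftCLM_apply_apply hr]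
    using integrable_norm_sq (SchwartzMap.smulLeftCLM F r φ) μ

theorem hasBochnerIntegral_chirpEnergy (v : D) {r : D → ℝ} (hr : r.HasTemperateGrowth)
    (φ : 𝓢(D, F)) (μ : Measure D) [μ.IsAddHaarMeasure] :
    HasBochnerIntegral (fun x => ‖∂_{v} φ x‖ ^ 2 + ‖r x • φ x‖ ^ 2) (chirpEnergy v r φ μ) μ :=
  ⟨(integrable_norm_sq (∂_{v} φ) μ).add (integrable_norm_smul_sq φ hr μ), rfl⟩

theorem integral_norm_lineDerivOp_sq_le_chirpEnergy (v : D) {r : D → ℝ}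
    (hr : r.HasTemperateGrowth) (φ : 𝓢(D, F)) (μ : Measure D) [μ.IsAddHaarMeasure] :
    ∫ x, ‖∂_{v} φ x‖ ^ 2 ∂μ ≤ chirpEnergy v r φ μ :=
  integral_mono (integrable_norm_sq (∂_{v} φ) μ) (hasBochnerIntegral_chirpEnergy v hr φ μ).1
    fun _ => le_add_of_nonneg_right (sq_nonneg _)

end Schwartz

section Chirp

theorem hasTemperateGrowth_cexp_ofReal_mul_I :
    (fun x : ℝ => Complex.exp (x * Complex.I)).HasTemperateGrowth := by
  have hderiv (n : ℕ) : iteratedDeriv n (fun x : ℝ => Complex.exp (x * Complex.I)) =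
      fun x : ℝ => Complex.I ^ n * Complex.exp (x * Complex.I) := by
    induction n with
    | zero => simp
    | succ n ih =>
      rw [iteratedDeriv_succ, ih]
      funext x
      have hlin : HasDerivAt (fun x : ℝ => (x : ℂ) * Complex.I) Complex.I x := by
        simpa using (Complex.ofRealCLM.hasDerivAt (x := x)).mul_const Complex.I
      rw [(hlin.cexp.const_mul (Complex.I ^ n)).deriv]
      ring
  refine ⟨(Complex.ofRealCLM.contDiff.mul contDiff_const).cexp, fun n => ⟨0, 1, fun x => ?_⟩⟩
  rw [norm_iteratedFDeriv_eq_norm_iteratedDeriv, hderiv]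
  simp [Complex.norm_exp]

variable {V : Type*} [NormedAddCommGroup V] [NormedSpace ℝ V]

/-- The product `e^{iQ} φ` of a real-valued Schwartz function with a chirp. It is the Schwartz
function with these values only for a phase `Q` of temperate growth. -/
noncomputable def chirp (Q : V → ℝ) (φ : 𝓢(V, ℝ)) : 𝓢(V, ℂ) :=
  SchwartzMap.smulLeftCLM ℂ (fun x => Complex.exp (Q x * Complex.I))
    (SchwartzMap.postcompCLM (𝕜 := ℝ) Complex.ofRealCLM φ)

theorem chirp_apply {Q : V → ℝ} (hQ : Q.HasTemperateGrowth) (φ : 𝓢(V, ℝ)) (x : V) :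
    chirp Q φ x = Complex.exp (Q x * Complex.I) * φ x := by
  have hexp : (fun x => Complex.exp (Q x * Complex.I)).HasTemperateGrowth :=
    hasTemperateGrowth_cexp_ofReal_mul_I.comp hQ
  simp [chirp, hexp]

theorem norm_lineDerivOp_chirp_sq {Q : V → ℝ} (hQ : Q.HasTemperateGrowth) (φ : 𝓢(V, ℝ))
    {v x : V} {q : ℝ} (hq : HasLineDerivAt ℝ Q q x v) :
    ‖∂_{v} (chirp Q φ) x‖ ^ 2 = ‖∂_{v} φ x‖ ^ 2 + ‖q • φ x‖ ^ 2 := by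
  have hφ : HasLineDerivAt ℝ φ (∂_{v} φ x) x v := by
    rw [SchwartzMap.lineDerivOp_apply_eq_fderiv]
    exact (φ.hasFDerivAt x).hasLineDerivAt v
  have hchirp : HasLineDerivAt ℝ (chirp Q φ)
      (Complex.exp (Q x * Complex.I) * (∂_{v} φ x + (q * φ x : ℝ) * Complex.I)) x v := by
    rw [show (chirp Q φ : V → ℂ) = _ from funext (chirp_apply hQ φ)]
    refine (((hq.ofReal_comp).mul_const Complex.I).cexp.fun_mul hφ.ofReal_comp).congr_deriv ?_
    simp only [zero_smul, add_zero, Complex.ofReal_mul]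
    ring
  rw [SchwartzMap.lineDerivOp_apply, hchirp.lineDeriv, norm_mul, Complex.norm_exp_ofReal_mul_I,
    one_mul, Complex.sq_norm, Complex.normSq_add_mul_I]
  simp only [smul_eq_mul, Real.norm_eq_abs, sq_abs]

end Chirp

section Fourier

variable {V : Type*} [NormedAddCommGroup V] [InnerProductSpace ℝ V] [FiniteDimensional ℝ V]
  [MeasurableSpace V] [BorelSpace V]

theorem inner_sq_mul_norm_fourier_sq (ψ : 𝓢(V, ℂ)) (v w : V) :
    ⟪w, v⟫ ^ 2 * ‖𝓕 (ψ : V → ℂ) w‖ ^ 2 = 1 / (4 * Real.pi ^ 2) * ‖𝓕 (∂_{v} ψ) w‖ ^ 2 := by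
  rw [SchwartzMap.fourier_lineDerivOp_eq, smul_apply,
    SchwartzMap.smulLeftCLM_apply_apply (Function.hasTemperateGrowth_inner_left v),
    SchwartzMap.fourier_coe, norm_smul, norm_smul]
  simp only [norm_mul, Complex.norm_ofNat, Complex.norm_real, Complex.norm_I, Real.norm_eq_abs,
    mul_pow, sq_abs]
  field_simp [Real.pi_ne_zero]
  ring

theorem hasBochnerIntegral_inner_sq_mul_norm_fourier_chirp_sq {Q r : V → ℝ}
    (hQ : Q.HasTemperateGrowth) {v : V} (hr : ∀ x, HasLineDerivAt ℝ Q (r x) x v) (φ : 𝓢(V, ℝ)) :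
    HasBochnerIntegral (fun w => ⟪w, v⟫ ^ 2 * ‖𝓕 (chirp Q φ : V → ℂ) w‖ ^ 2)
      (1 / (4 * Real.pi ^ 2) * chirpEnergy v r φ volume) volume := by
  have hplancherel : HasBochnerIntegral (fun w => ‖𝓕 (∂_{v} (chirp Q φ)) w‖ ^ 2)
      (chirpEnergy v r φ volume) volume := by
    refine ⟨integrable_norm_sq _ volume, ?_⟩
    rw [SchwartzMap.integral_norm_sq_fourier]
    simp only [norm_lineDerivOp_chirp_sq hQ φ (hr _), chirpEnergy]
  simpa only [inner_sq_mul_norm_fourier_sq] using hplancherel.const_mul (1 / (4 * Real.pi ^ 2))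

theorem norm_integral_cexp_mul_eq_norm_fourier_chirp {Q θ : V → ℝ} (hQ : Q.HasTemperateGrowth)
    (φ : 𝓢(V, ℝ)) {w : V} {c : ℝ} (hθ : ∀ x, θ x = Q x - 2 * Real.pi * ⟪x, w⟫ + c) :
    ‖∫ x, Complex.exp (θ x * Complex.I) * φ x‖ = ‖𝓕 (chirp Q φ : V → ℂ) w‖ := by
  have hphase (x : V) : Complex.exp (θ x * Complex.I) * φ x = Complex.exp (c * Complex.I) *
      (Complex.exp (↑(-2 * Real.pi * ⟪x, w⟫) * Complex.I) • chirp Q φ x) := by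
    rw [chirp_apply hQ, hθ, smul_eq_mul, ← mul_assoc, ← mul_assoc, ← Complex.exp_add,
      ← Complex.exp_add]
    congr 2
    push_cast
    ring
  simp_rw [hphase]
  rw [integral_const_mul, norm_mul, Complex.norm_exp_ofReal_mul_I, one_mul, Real.fourier_eq']

end Fourier

section Slice

variable {D E F : Type*} [NormedAddCommGroup D] [NormedSpace ℝ D] [NormedAddCommGroup E]
  [NormedSpace ℝ E] [NormedAddCommGroup F] [NormedSpace ℝ F]

theorem hasTemperateGrowth_prodMk_left (x : D) :
    (fun y : E => (x, y)).HasTemperateGrowth := by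
  convert (Function.HasTemperateGrowth.const ((x, 0) : D × E)).add
    (ContinuousLinearMap.inr ℝ D E).hasTemperateGrowth using 1
  ext y <;> simp

/-- The restriction `y ↦ Φ (x, y)` of a Schwartz function on a product. -/
noncomputable def slice (Φ : 𝓢(D × E, F)) (x : D) : 𝓢(E, F) :=
  SchwartzMap.compCLMOfAntilipschitz ℝ (K := 1) (g := fun y => (x, y))
    (hasTemperateGrowth_prodMk_left x)
    (Isometry.antilipschitz (Isometry.of_dist_eq fun y z => by simp [Prod.dist_eq])) Φ

theorem slice_apply (Φ : 𝓢(D × E, F)) (x : D) (y : E) : slice Φ x y = Φ (x, y) := rfl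

theorem lineDerivOp_slice (Φ : 𝓢(D × E, F)) (v : E) (x : D) (y : E) :
    ∂_{v} (slice Φ x) y = ∂_{((0 : D), v)} Φ (x, y) := by
  simp only [SchwartzMap.lineDerivOp_apply, lineDeriv, slice_apply, Prod.mk_add_mk, Prod.smul_mk,
    smul_zero, add_zero]

variable [MeasurableSpace D] [BorelSpace D]

theorem hasBochnerIntegral_chirpEnergy_slice [FiniteDimensional ℝ D] [FiniteDimensional ℝ E]
    [MeasurableSpace E] [BorelSpace E] (Φ : 𝓢(D × E, F)) (v : E) {r : E → ℝ}
    (hr : r.HasTemperateGrowth) (μ : Measure D) [μ.IsAddHaarMeasure] (ν : Measure E)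
    [ν.IsAddHaarMeasure] :
    HasBochnerIntegral (fun x => chirpEnergy v r (slice Φ x) ν)
      (chirpEnergy (0, v) (fun p : D × E => r p.2) Φ (μ.prod ν)) μ := by
  simpa only [chirpEnergy, lineDerivOp_slice, slice_apply, Function.comp_apply,
    ContinuousLinearMap.coe_snd'] using (hasBochnerIntegral_chirpEnergy (0, v)
      (hr.comp (ContinuousLinearMap.snd ℝ D E).hasTemperateGrowth) Φ
      (μ.prod ν)).integral_prod_left

variable {V : Type*} [NormedAddCommGroup V] [InnerProductSpace ℝ V] [FiniteDimensional ℝ V]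
  [MeasurableSpace V] [BorelSpace V]

theorem stronglyMeasurable_fourier_chirp_slice (Φ : 𝓢(D × V, ℝ)) {Q : V → ℝ}
    (hQ : Q.HasTemperateGrowth) :
    StronglyMeasurable fun p : D × V => 𝓕 (chirp Q (slice Φ p.1) : V → ℂ) p.2 := by
  have hQc : Continuous Q := hQ.1.continuous
  have hΦc : Continuous Φ := Φ.continuous
  have hintegrand : StronglyMeasurable fun z : (D × V) × V =>
      Complex.exp (↑(-2 * Real.pi * ⟪z.2, z.1.2⟫) * Complex.I) •
        (Complex.exp (Q z.2 * Complex.I) * (Φ (z.1.1, z.2) : ℂ)) := by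
    apply Continuous.stronglyMeasurable
    fun_prop
  simpa only [Real.fourier_eq', chirp_apply hQ, slice_apply]
    using hintegrand.integral_prod_right' (ν := (volume : Measure V))

theorem hasBochnerIntegral_inner_sq_mul_norm_fourier_chirp_slice_sq [FiniteDimensional ℝ D]
    (Φ : 𝓢(D × V, ℝ)) {Q r : V → ℝ} (hQ : Q.HasTemperateGrowth) (hr : r.HasTemperateGrowth) {v : V}
    (hQr : ∀ y, HasLineDerivAt ℝ Q (r y) y v) (μ : Measure D) [μ.IsAddHaarMeasure] :
    HasBochnerIntegral
      (fun p : D × V => ⟪p.2, v⟫ ^ 2 * ‖𝓕 (chirp Q (slice Φ p.1) : V → ℂ) p.2‖ ^ 2)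
      (1 / (4 * Real.pi ^ 2) * chirpEnergy (0, v) (fun p : D × V => r p.2) Φ (μ.prod volume))
      (μ.prod volume) := by
  refine .prod_of_nonneg ?_ (fun p => by positivity)
    (fun x => hasBochnerIntegral_inner_sq_mul_norm_fourier_chirp_sq hQ hQr (slice Φ x))
    ((hasBochnerIntegral_chirpEnergy_slice Φ v hr μ volume).const_mul _)
  exact (StronglyMeasurable.mul (by fun_prop)
    ((stronglyMeasurable_fourier_chirp_slice Φ hQ).norm.pow 2)).aestronglyMeasurable

end Slice

section UnitExp

variable {ν : ℍ[ℝ]}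

theorem norm_eq_one_of_sq_eq_neg_one (hν : ν ^ 2 = -1) : ‖ν‖ = 1 := by
  have hsq : ‖ν‖ ^ 2 = 1 := by rw [← norm_pow, hν, norm_neg, norm_one]
  exact (pow_eq_one_iff_of_nonneg (norm_nonneg ν) two_ne_zero).1 hsq

theorem re_eq_zero_of_sq_eq_neg_one (hν : ν ^ 2 = -1) : ν.re = 0 := by
  rw [← Quaternion.sq_eq_neg_normSq, Quaternion.normSq_eq_norm_mul_self,
    norm_eq_one_of_sq_eq_neg_one hν, hν, mul_one, Quaternion.coe_one]

/-- The embedding `x + i y ↦ x + ν y` of the complex numbers into the quaternions, for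
`ν² = -1`. -/
noncomputable def complexEmbedding (ν : ℍ[ℝ]) (hν : ν ^ 2 = -1) : ℂ →ₐ[ℝ] ℍ[ℝ] :=
  Complex.liftAux ν (by rw [← sq, hν])

theorem complexEmbedding_apply (hν : ν ^ 2 = -1) (z : ℂ) :
    complexEmbedding ν hν z = (z.re : ℍ[ℝ]) + z.im • ν := rfl

theorem complexEmbedding_exp_ofReal_mul_I (hν : ν ^ 2 = -1) (θ : ℝ) :
    complexEmbedding ν hν (Complex.exp (θ * Complex.I)) = unitExp ν θ := by
  rw [complexEmbedding_apply, Complex.exp_ofReal_mul_I_re, Complex.exp_ofReal_mul_I_im, unitExp,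
    Quaternion.mul_coe_eq_smul]

theorem norm_complexEmbedding (hν : ν ^ 2 = -1) (z : ℂ) : ‖complexEmbedding ν hν z‖ = ‖z‖ := by
  rw [← sq_eq_sq₀ (norm_nonneg _) (norm_nonneg _), complexEmbedding_apply, norm_add_sq_real,
    Quaternion.inner_def, norm_smul, norm_eq_one_of_sq_eq_neg_one hν, Complex.sq_norm,
    Complex.normSq_apply]
  simp [re_eq_zero_of_sq_eq_neg_one hν, sq]

theorem unitExp_add (hν : ν ^ 2 = -1) (x y : ℝ) :
    unitExp ν (x + y) = unitExp ν x * unitExp ν y := by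
  simp only [← complexEmbedding_exp_ofReal_mul_I hν, ← map_mul, ← Complex.exp_add,
    Complex.ofReal_add, add_mul]

theorem norm_unitExp (hν : ν ^ 2 = -1) (x : ℝ) : ‖unitExp ν x‖ = 1 := by
  rw [← complexEmbedding_exp_ofReal_mul_I hν, norm_complexEmbedding,
    Complex.norm_exp_ofReal_mul_I]

theorem unitExp_neg_left (ν : ℍ[ℝ]) (θ : ℝ) : unitExp (-ν) θ = unitExp ν (-θ) := by
  simp [unitExp]

theorem norm_principalSqrt_sq (hν : ν ^ 2 = -1) (x : ℝ) : ‖principalSqrt ν x‖ ^ 2 = |x| := by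
  unfold principalSqrt
  split_ifs with hx
  · rw [Quaternion.norm_coe, Real.norm_eq_abs, sq_abs, Real.sq_sqrt hx, abs_of_nonneg hx]
  · rw [norm_mul, norm_eq_one_of_sq_eq_neg_one hν, one_mul, Quaternion.norm_coe, Real.norm_eq_abs,
      sq_abs, Real.sq_sqrt (by linarith), abs_of_neg (not_le.1 hx)]

theorem norm_degenerateFactor_sq (hν : ν ^ 2 = -1) (A : Params) (u : ℝ) :
    ‖degenerateFactor ν A u‖ ^ 2 = |A.d| := by
  rw [degenerateFactor, norm_mul, norm_unitExp hν, mul_one, norm_principalSqrt_sq hν]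

end UnitExp

section OrthogonalPlanes

variable {lam mu a b : ℍ[ℝ]}

theorem semiconjBy_unitExp (h : SemiconjBy a mu lam) (θ : ℝ) :
    SemiconjBy a (unitExp mu θ) (unitExp lam θ) :=
  have hreal (x : ℝ) : SemiconjBy a (x : ℍ[ℝ]) (x : ℍ[ℝ]) := (Quaternion.coe_commutes x a).symm
  (hreal _).add_right (h.mul_right (hreal _))

theorem norm_add_sq_of_semiconjBy (hlam : ‖lam‖ = 1) (hmu : ‖mu‖ = 1) (ha : SemiconjBy a mu lam)
    (hb : SemiconjBy b mu (-lam)) : ‖a + b‖ ^ 2 = ‖a‖ ^ 2 + ‖b‖ ^ 2 := by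
  have hnorm : ‖a + b‖ = ‖a - b‖ :=
    calc ‖a + b‖ = ‖(a + b) * mu‖ := by rw [norm_mul, hmu, mul_one]
      _ = ‖lam * (a - b)‖ := by rw [add_mul, ha.eq, hb.eq, neg_mul, ← sub_eq_add_neg, mul_sub]
      _ = ‖a - b‖ := by rw [norm_mul, hlam, one_mul]
  have hpar := parallelogram_law_with_norm ℝ a b
  rw [← hnorm] at hpar
  linarith

/-- The component `(1 - ε λ μ) / 2` of `1` in the orthogonal planes split of the quaternions, for a
sign `ε = ±1`. -/
noncomputable def planePart (lam mu : ℍ[ℝ]) (ε : ℝ) : ℍ[ℝ] :=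
  (1 / 2 : ℝ) • (1 - ε • (lam * mu))

theorem planePart_one_add_planePart_neg_one (lam mu : ℍ[ℝ]) :
    planePart lam mu 1 + planePart lam mu (-1) = 1 := by
  unfold planePart
  module

theorem semiconjBy_planePart (hlam : lam ^ 2 = -1) (hmu : mu ^ 2 = -1) {ε : ℝ} (hε : ε ^ 2 = 1) :
    SemiconjBy (planePart lam mu ε) mu (ε • lam) := by
  have hε' : ε * ε = 1 := by rw [← sq, hε]
  rw [SemiconjBy, planePart, smul_mul_assoc, mul_smul_comm, sub_mul, mul_sub, smul_mul_assoc,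
    mul_assoc lam, ← sq mu, hmu, smul_mul_smul_comm, hε', ← mul_assoc, ← sq lam, hlam]
  simp [add_comm]

theorem semiconjBy_planePart_one (hlam : lam ^ 2 = -1) (hmu : mu ^ 2 = -1) :
    SemiconjBy (planePart lam mu 1) mu lam := by
  simpa using semiconjBy_planePart hlam hmu (one_pow 2)

theorem semiconjBy_planePart_neg_one (hlam : lam ^ 2 = -1) (hmu : mu ^ 2 = -1) :
    SemiconjBy (planePart lam mu (-1)) mu (-lam) := by
  simpa using semiconjBy_planePart hlam hmu (ε := -1) (by norm_num)

theorem norm_planePart_sq_add (hlam : lam ^ 2 = -1) (hmu : mu ^ 2 = -1) :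
    ‖planePart lam mu 1‖ ^ 2 + ‖planePart lam mu (-1)‖ ^ 2 = 1 := by
  rw [← norm_add_sq_of_semiconjBy (norm_eq_one_of_sq_eq_neg_one hlam)
    (norm_eq_one_of_sq_eq_neg_one hmu) (semiconjBy_planePart_one hlam hmu)
    (semiconjBy_planePart_neg_one hlam hmu), planePart_one_add_planePart_neg_one, norm_one, one_pow]

theorem unitExp_mul_unitExp (hlam : lam ^ 2 = -1) (hmu : mu ^ 2 = -1) (α β : ℝ) :
    unitExp lam α * unitExp mu β = unitExp lam (α + β) * planePart lam mu 1
      + unitExp lam (α - β) * planePart lam mu (-1) := by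
  rw [unitExp_add hlam, sub_eq_add_neg, unitExp_add hlam, ← unitExp_neg_left, mul_assoc, mul_assoc,
    ← (semiconjBy_unitExp (semiconjBy_planePart_one hlam hmu) β).eq,
    ← (semiconjBy_unitExp (semiconjBy_planePart_neg_one hlam hmu) β).eq, ← mul_add, ← add_mul,
    planePart_one_add_planePart_neg_one, one_mul]

theorem norm_complexEmbedding_mul_planePart_add_sq (hlam : lam ^ 2 = -1) (hmu : mu ^ 2 = -1)
    (z w : ℂ) :
    ‖complexEmbedding lam hlam z * planePart lam mu 1
        + complexEmbedding lam hlam w * planePart lam mu (-1)‖ ^ 2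
      = ‖planePart lam mu 1‖ ^ 2 * ‖z‖ ^ 2 + ‖planePart lam mu (-1)‖ ^ 2 * ‖w‖ ^ 2 := by
  have hcomm (z : ℂ) : Commute (complexEmbedding lam hlam z) lam := by
    rw [complexEmbedding_apply]
    exact (Quaternion.coe_commute _ _).add_left ((Commute.refl lam).smul_left _)
  rw [norm_add_sq_of_semiconjBy (norm_eq_one_of_sq_eq_neg_one hlam)
    (norm_eq_one_of_sq_eq_neg_one hmu)
    ((hcomm z).semiconjBy.mul_left (semiconjBy_planePart_one hlam hmu))
    ((hcomm w).neg_right.semiconjBy.mul_left (semiconjBy_planePart_neg_one hlam hmu)), norm_mul,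
    norm_mul, norm_complexEmbedding, norm_complexEmbedding]
  ring

end OrthogonalPlanes

section OscillatoryIntegral

variable {α : Type*} [MeasurableSpace α] {m : Measure α} {ν lam mu : ℍ[ℝ]}

theorem integrable_cexp_ofReal_mul_I_mul {θ φ : α → ℝ} (hθ : Measurable θ) (hφ : Integrable φ m) :
    Integrable (fun x => Complex.exp (θ x * Complex.I) * φ x) m :=
  hφ.ofReal.bdd_mul (c := 1) (by fun_prop)
    (.of_forall fun x => (Complex.norm_exp_ofReal_mul_I _).le)

theorem complexEmbedding_exp_mul_ofReal (hν : ν ^ 2 = -1) (θ r : ℝ) :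
    complexEmbedding ν hν (Complex.exp (θ * Complex.I) * r) = unitExp ν θ * (r : ℍ[ℝ]) := by
  rw [map_mul, complexEmbedding_exp_ofReal_mul_I, ← Complex.coe_algebraMap, AlgHom.commutes]
  rfl

/-- `complexEmbedding` as a linear isometry, which commutes with integrals. -/
noncomputable def complexIsometry (ν : ℍ[ℝ]) (hν : ν ^ 2 = -1) : ℂ →ₗᵢ[ℝ] ℍ[ℝ] :=
  ⟨(complexEmbedding ν hν).toLinearMap, norm_complexEmbedding hν⟩

theorem integrable_complexEmbedding (hν : ν ^ 2 = -1) {F : α → ℂ} (hF : Integrable F m) :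
    Integrable (fun x => complexEmbedding ν hν (F x)) m :=
  (complexIsometry ν hν).toContinuousLinearMap.integrable_comp hF

theorem integral_complexEmbedding (hν : ν ^ 2 = -1) (F : α → ℂ) :
    ∫ x, complexEmbedding ν hν (F x) ∂m = complexEmbedding ν hν (∫ x, F x ∂m) :=
  (complexIsometry ν hν).integral_comp_comm F

theorem norm_integral_mul_unitExp_mul_mul (hν : ν ^ 2 = -1) {θ φ : α → ℝ} (hθ : Measurable θ)
    (hφ : Integrable φ m) (p q : ℍ[ℝ]) :
    ‖∫ x, p * (unitExp ν (θ x) * (φ x : ℍ[ℝ])) * q ∂m‖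
      = ‖p‖ * ‖∫ x, Complex.exp (θ x * Complex.I) * φ x ∂m‖ * ‖q‖ := by
  have hint := integrable_complexEmbedding hν (integrable_cexp_ofReal_mul_I_mul hθ hφ)
  simp only [← complexEmbedding_exp_mul_ofReal hν]
  rw [integral_mul_const_of_integrable (hint.const_mul p), integral_const_mul_of_integrable hint,
    integral_complexEmbedding, norm_mul, norm_mul, norm_complexEmbedding]

theorem norm_integral_unitExp_mul_mul_unitExp_sq (hlam : lam ^ 2 = -1) (hmu : mu ^ 2 = -1)
    {θ η φ : α → ℝ} (hθ : Measurable θ) (hη : Measurable η) (hφ : Integrable φ m) :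
    ‖∫ x, unitExp lam (θ x) * (φ x : ℍ[ℝ]) * unitExp mu (η x) ∂m‖ ^ 2
      = ‖planePart lam mu 1‖ ^ 2 * ‖∫ x, Complex.exp (↑(θ x + η x) * Complex.I) * φ x ∂m‖ ^ 2
        + ‖planePart lam mu (-1)‖ ^ 2
          * ‖∫ x, Complex.exp (↑(θ x - η x) * Complex.I) * φ x ∂m‖ ^ 2 := by
  have hsplit (x : α) : unitExp lam (θ x) * (φ x : ℍ[ℝ]) * unitExp mu (η x)
      = complexEmbedding lam hlam (Complex.exp (↑(θ x + η x) * Complex.I) * φ x)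
          * planePart lam mu 1
        + complexEmbedding lam hlam (Complex.exp (↑(θ x - η x) * Complex.I) * φ x)
          * planePart lam mu (-1) := by
    rw [← Quaternion.coe_commutes, mul_assoc, unitExp_mul_unitExp hlam hmu,
      complexEmbedding_exp_mul_ofReal, complexEmbedding_exp_mul_ofReal, ← Quaternion.coe_commutes,
      ← Quaternion.coe_commutes, mul_add, mul_assoc, mul_assoc]
  have hplus := integrable_complexEmbedding hlam
    (integrable_cexp_ofReal_mul_I_mul (hθ.fun_add hη) hφ)
  have hminus := integrable_complexEmbedding hlam
    (integrable_cexp_ofReal_mul_I_mul (hθ.fun_sub hη) hφ)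
  simp only [hsplit]
  rw [integral_add (hplus.mul_const _) (hminus.mul_const _), integral_mul_const_of_integrable hplus,
    integral_mul_const_of_integrable hminus, integral_complexEmbedding, integral_complexEmbedding]
  exact norm_complexEmbedding_mul_planePart_add_sq hlam hmu _ _

end OscillatoryIntegral

section Tensor

variable {D E F G K : Type*} [NormedAddCommGroup D] [NormedSpace ℝ D] [NormedAddCommGroup E]
  [NormedSpace ℝ E] [NormedAddCommGroup F] [NormedSpace ℝ F] [NormedAddCommGroup G]
  [NormedSpace ℝ G] [NormedAddCommGroup K] [NormedSpace ℝ K]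

theorem norm_iteratedFDeriv_comp_le_of_opNorm_le_one {f : E → F} {n : ℕ}
    (hf : ContDiff ℝ n f) {L : D →L[ℝ] E} (hL : ‖L‖ ≤ 1) (x : D) :
    ‖iteratedFDeriv ℝ n (fun x => f (L x)) x‖ ≤ ‖iteratedFDeriv ℝ n f (L x)‖ := by
  change ‖iteratedFDeriv ℝ n (f ∘ L) x‖ ≤ _
  rw [L.iteratedFDeriv_comp_right hf x le_rfl]
  refine (ContinuousMultilinearMap.norm_compContinuousLinearMap_le _ _).trans ?_
  exact mul_le_of_le_one_right (norm_nonneg _)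
    (Finset.prod_le_one (fun _ _ => norm_nonneg _) fun _ _ => hL)

theorem norm_pow_mul_norm_iteratedFDeriv_mul_le (f : 𝓢(D, F)) (g : 𝓢(E, G)) (k i j : ℕ)
    (p : D × E) :
    ‖p‖ ^ k * (‖iteratedFDeriv ℝ i f p.1‖ * ‖iteratedFDeriv ℝ j g p.2‖) ≤
      SchwartzMap.seminorm ℝ k i f * SchwartzMap.seminorm ℝ 0 j g +
        SchwartzMap.seminorm ℝ 0 i f * SchwartzMap.seminorm ℝ k j g := by
  have hpow : ‖p‖ ^ k ≤ ‖p.1‖ ^ k + ‖p.2‖ ^ k := by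
    rcases max_choice ‖p.1‖ ‖p.2‖ with h | h <;> rw [Prod.norm_def, h]
    exacts [le_add_of_nonneg_right (by positivity), le_add_of_nonneg_left (by positivity)]
  calc
    _ ≤ (‖p.1‖ ^ k + ‖p.2‖ ^ k) *
        (‖iteratedFDeriv ℝ i f p.1‖ * ‖iteratedFDeriv ℝ j g p.2‖) := by gcongr
    _ = ‖p.1‖ ^ k * ‖iteratedFDeriv ℝ i f p.1‖ * (‖p.2‖ ^ 0 * ‖iteratedFDeriv ℝ j g p.2‖) +
        ‖p.1‖ ^ 0 * ‖iteratedFDeriv ℝ i f p.1‖ * (‖p.2‖ ^ k * ‖iteratedFDeriv ℝ j g p.2‖) := by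
      ring
    _ ≤ _ := by gcongr <;> exact SchwartzMap.le_seminorm ..

theorem exists_norm_pow_mul_norm_iteratedFDeriv_bilinear_le (B : F →L[ℝ] G →L[ℝ] K)
    (f : 𝓢(D, F)) (g : 𝓢(E, G)) (k n : ℕ) :
    ∃ C, ∀ p : D × E, ‖p‖ ^ k * ‖iteratedFDeriv ℝ n (fun p => B (f p.1) (g p.2)) p‖ ≤ C := by
  refine ⟨‖B‖ * ∑ i ∈ Finset.range (n + 1), n.choose i *
    (SchwartzMap.seminorm ℝ k i f * SchwartzMap.seminorm ℝ 0 (n - i) g +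
      SchwartzMap.seminorm ℝ 0 i f * SchwartzMap.seminorm ℝ k (n - i) g), fun p => ?_⟩
  have hfst : ContDiff ℝ n fun p : D × E => f p.1 := (f.smooth n).comp contDiff_fst
  have hsnd : ContDiff ℝ n fun p : D × E => g p.2 := (g.smooth n).comp contDiff_snd
  calc
    _ ≤ ‖p‖ ^ k * (‖B‖ * ∑ i ∈ Finset.range (n + 1), n.choose i *
        ‖iteratedFDeriv ℝ i (fun p : D × E => f p.1) p‖ *
        ‖iteratedFDeriv ℝ (n - i) (fun p : D × E => g p.2) p‖) := by
      gcongr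
      exact B.norm_iteratedFDeriv_le_of_bilinear hfst hsnd p le_rfl
    _ ≤ ‖p‖ ^ k * (‖B‖ * ∑ i ∈ Finset.range (n + 1), n.choose i *
        ‖iteratedFDeriv ℝ i f p.1‖ * ‖iteratedFDeriv ℝ (n - i) g p.2‖) := by
      gcongr
      exacts [norm_iteratedFDeriv_comp_le_of_opNorm_le_one (f.smooth _)
          (ContinuousLinearMap.norm_fst_le ℝ D E) p,
        norm_iteratedFDeriv_comp_le_of_opNorm_le_one (g.smooth _)
          (ContinuousLinearMap.norm_snd_le ℝ D E) p]
    _ = ‖B‖ * ∑ i ∈ Finset.range (n + 1), n.choose i *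
        (‖p‖ ^ k * (‖iteratedFDeriv ℝ i f p.1‖ * ‖iteratedFDeriv ℝ (n - i) g p.2‖)) := by
      rw [mul_left_comm, Finset.mul_sum]
      simp only [mul_left_comm, mul_assoc]
    _ ≤ _ := by
      gcongr
      exact norm_pow_mul_norm_iteratedFDeriv_mul_le f g k _ _ p

/-- The Schwartz function `(x, y) ↦ B (f x) (g y)`, the tensor product of `f` and `g` followed by
the bilinear map `B`. -/
noncomputable def tensorBilin (B : F →L[ℝ] G →L[ℝ] K) (f : 𝓢(D, F)) (g : 𝓢(E, G)) :
    𝓢(D × E, K) where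
  toFun p := B (f p.1) (g p.2)
  smooth' := B.isBoundedBilinearMap.contDiff.comp
    (((f.smooth ⊤).comp contDiff_fst).prodMk ((g.smooth ⊤).comp contDiff_snd))
  decay' := exists_norm_pow_mul_norm_iteratedFDeriv_bilinear_le B f g

end Tensor

section Heisenberg

variable {D F : Type*} [NormedAddCommGroup D] [NormedSpace ℝ D] [NormedAddCommGroup F]
  [InnerProductSpace ℝ F]

theorem lineDerivOp_smulLeftCLM (L : D →L[ℝ] ℝ) (h : 𝓢(D, F)) (v x : D) :
    ∂_{v} (SchwartzMap.smulLeftCLM F L h) x = L x • ∂_{v} h x + L v • h x := by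
  have hcoe : (SchwartzMap.smulLeftCLM F L h : D → F) = fun x => L x • h x :=
    funext (SchwartzMap.smulLeftCLM_apply_apply L.hasTemperateGrowth h)
  rw [SchwartzMap.lineDerivOp_apply_eq_fderiv, hcoe,
    (L.hasFDerivAt.fun_smul (h.hasFDerivAt x)).fderiv, SchwartzMap.lineDerivOp_apply_eq_fderiv]
  simp

variable [FiniteDimensional ℝ D] [MeasurableSpace D] [BorelSpace D]

theorem sq_integral_inner_le (f g : 𝓢(D, F)) (μ : Measure D) [μ.IsAddHaarMeasure] :
    (∫ x, ⟪f x, g x⟫ ∂μ) ^ 2 ≤ (∫ x, ‖f x‖ ^ 2 ∂μ) * ∫ x, ‖g x‖ ^ 2 ∂μ := by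
  have hinner (f g : 𝓢(D, F)) : ⟪f.toLp 2 μ, g.toLp 2 μ⟫ = ∫ x, ⟪f x, g x⟫ ∂μ := by
    rw [L2.inner_def]
    apply integral_congr_ae
    filter_upwards [f.coeFn_toLp 2 μ, g.coeFn_toLp 2 μ] with x hf hg
    rw [hf, hg]
  simpa only [hinner, real_inner_self_eq_norm_sq, ← sq]
    using real_inner_mul_inner_self_le (f.toLp 2 μ) (g.toLp 2 μ)

theorem two_mul_integral_inner_smul_lineDerivOp (L : D →L[ℝ] ℝ) (v : D) (h : 𝓢(D, F))
    (μ : Measure D) [μ.IsAddHaarMeasure] :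
    2 * ∫ x, ⟪SchwartzMap.smulLeftCLM F L h x, ∂_{v} h x⟫ ∂μ = -(L v * ∫ x, ‖h x‖ ^ 2 ∂μ) := by
  have hparts : ∫ x, ⟪SchwartzMap.smulLeftCLM F L h x, ∂_{v} h x⟫ ∂μ =
      -∫ x, ⟪∂_{v} (SchwartzMap.smulLeftCLM F L h) x, h x⟫ ∂μ :=
    SchwartzMap.integral_bilinear_lineDerivOp_right_eq_neg_left _ h (innerSL ℝ) v
  have hproduct (x : D) : ⟪∂_{v} (SchwartzMap.smulLeftCLM F L h) x, h x⟫ =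
      ⟪SchwartzMap.smulLeftCLM F L h x, ∂_{v} h x⟫ + L v * ‖h x‖ ^ 2 := by
    rw [lineDerivOp_smulLeftCLM, SchwartzMap.smulLeftCLM_apply_apply L.hasTemperateGrowth,
      inner_add_left, real_inner_smul_left, real_inner_smul_left, real_inner_smul_left,
      real_inner_self_eq_norm_sq, real_inner_comm]
  have hinner : Integrable (fun x => ⟪SchwartzMap.smulLeftCLM F L h x, ∂_{v} h x⟫) μ :=
    (SchwartzMap.bilinLeftCLM (innerSL ℝ) (∂_{v} h).hasTemperateGrowth _).integrable
  simp_rw [hproduct] at hparts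
  rw [integral_add hinner ((integrable_norm_sq h μ).const_mul _), integral_const_mul] at hparts
  linear_combination hparts

theorem heisenberg_inequality (L : D →L[ℝ] ℝ) (v : D) (h : 𝓢(D, F)) (μ : Measure D)
    [μ.IsAddHaarMeasure] :
    L v ^ 2 * (∫ x, ‖h x‖ ^ 2 ∂μ) ^ 2 ≤
      4 * ((∫ x, ‖L x • h x‖ ^ 2 ∂μ) * ∫ x, ‖∂_{v} h x‖ ^ 2 ∂μ) := by
  calc
    _ = 4 * (∫ x, ⟪SchwartzMap.smulLeftCLM F L h x, ∂_{v} h x⟫ ∂μ) ^ 2 := by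
      linear_combination (-(L v * ∫ x, ‖h x‖ ^ 2 ∂μ) +
        2 * ∫ x, ⟪SchwartzMap.smulLeftCLM F L h x, ∂_{v} h x⟫ ∂μ) *
          -two_mul_integral_inner_smul_lineDerivOp L v h μ
    _ ≤ _ := by
      gcongr
      simpa only [SchwartzMap.smulLeftCLM_apply_apply L.hasTemperateGrowth]
        using sq_integral_inner_le (SchwartzMap.smulLeftCLM F L h) (∂_{v} h) μ

end Heisenberg

section CrossSignal

variable {V : Type*} [NormedAddCommGroup V] [NormedSpace ℝ V]

/-- The change of variables `(t, s) ↦ (t + s/2, t - s/2)` behind the cross signal. -/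
noncomputable def centeredPairEquiv (V : Type*) [NormedAddCommGroup V] [NormedSpace ℝ V] :
    (V × V) ≃L[ℝ] V × V :=
  .equivOfInverse
    ((ContinuousLinearMap.fst ℝ V V + (1 / 2 : ℝ) • .snd ℝ V V).prod
      (ContinuousLinearMap.fst ℝ V V - (1 / 2 : ℝ) • .snd ℝ V V))
    (((1 / 2 : ℝ) • (ContinuousLinearMap.fst ℝ V V + .snd ℝ V V)).prod
      (ContinuousLinearMap.fst ℝ V V - .snd ℝ V V))
    (fun p => by ext1 <;> simp <;> module) (fun p => by ext1 <;> simp <;> module)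

theorem centeredPairEquiv_apply (p : V × V) :
    centeredPairEquiv V p = (p.1 + (1 / 2 : ℝ) • p.2, p.1 - (1 / 2 : ℝ) • p.2) := rfl

theorem measurePreserving_centeredPairEquiv [FiniteDimensional ℝ V] [MeasurableSpace V]
    [BorelSpace V] (μ : Measure V) [μ.IsAddHaarMeasure] :
    MeasurePreserving (centeredPairEquiv V) (μ.prod μ) (μ.prod μ) := by
  have hshear : MeasurePreserving (fun p : V × V => (p.1, p.2 + (1 / 2 : ℝ) • p.1))
      (μ.prod μ) (μ.prod μ) :=
    (MeasurePreserving.id μ).skew_product (g := fun s t : V => t + (1 / 2 : ℝ) • s) (by fun_prop)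
      (.of_forall fun s => (measurePreserving_add_right μ _).map_eq)
  have hreflect : MeasurePreserving (fun p : V × V => (p.1, p.1 - p.2)) (μ.prod μ) (μ.prod μ) :=
    (MeasurePreserving.id μ).skew_product (g := fun u s : V => u - s) (by fun_prop)
      (.of_forall fun u => (Measure.measurePreserving_sub_left μ u).map_eq)
  have hswap : MeasurePreserving Prod.swap (μ.prod μ) (μ.prod μ) := Measure.measurePreserving_swap
  convert hreflect.comp (hswap.comp (hshear.comp hswap)) using 1
  funext p
  simp only [centeredPairEquiv_apply, Function.comp_apply, Prod.swap, Prod.mk.injEq, true_and]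
  module

/-- The real bilinear map `(p, q) ↦ p * star q`. -/
noncomputable def mulStar : ℍ[ℝ] →L[ℝ] ℍ[ℝ] →L[ℝ] ℍ[ℝ] :=
  (ContinuousLinearMap.mul ℝ ℍ[ℝ]).bilinearComp (.id ℝ ℍ[ℝ]) <| LinearMap.toContinuousLinearMap
    { toFun := star
      map_add' := star_add
      map_smul' := Quaternion.star_smul }

/-- The cross signal `(t, s) ↦ f (t + s/2) * star (g (t - s/2))` as a Schwartz function of both
variables. -/
noncomputable def crossSchwartz (f g : 𝓢(Plane, ℍ[ℝ])) : 𝓢(Plane × Plane, ℍ[ℝ]) :=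
  SchwartzMap.compCLMOfContinuousLinearEquiv ℝ (centeredPairEquiv Plane) (tensorBilin mulStar f g)

theorem coe_slice_crossSchwartz (f g : 𝓢(Plane, ℍ[ℝ])) (t : Plane) :
    ⇑(slice (crossSchwartz f g) t) = crossSignal f g t := rfl

theorem integral_norm_crossSchwartz_sq (f g : 𝓢(Plane, ℍ[ℝ])) :
    ∫ p, ‖crossSchwartz f g p‖ ^ 2 ∂(volume.prod volume)
      = (∫ u, ‖f u‖ ^ 2) * ∫ v, ‖g v‖ ^ 2 := by
  have hnorm (p : Plane × Plane) : ‖crossSchwartz f g p‖ ^ 2 =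
      ‖f (centeredPairEquiv Plane p).1‖ ^ 2 * ‖g (centeredPairEquiv Plane p).2‖ ^ 2 := by
    rw [← mul_pow, ← Quaternion.norm_star (g _), ← norm_mul]
    rfl
  simp_rw [hnorm]
  rw [(measurePreserving_centeredPairEquiv volume).integral_comp
    (centeredPairEquiv Plane).toHomeomorph.measurableEmbedding fun p => ‖f p.1‖ ^ 2 * ‖g p.2‖ ^ 2]
  exact integral_prod_mul (fun u => ‖f u‖ ^ 2) fun v => ‖g v‖ ^ 2

theorem l2Norm_pow_four (f : Plane → ℍ[ℝ]) : l2Norm f ^ 4 = (∫ t, ‖f t‖ ^ 2) ^ 2 := by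
  rw [l2Norm, show 4 = 2 * 2 from rfl, pow_mul, Real.sq_sqrt (integral_nonneg fun t => sq_nonneg _)]

theorem sq_integral_norm_crossSchwartz_sq (f g : 𝓢(Plane, ℍ[ℝ])) :
    (∫ p, ‖crossSchwartz f g p‖ ^ 2 ∂(volume.prod volume)) ^ 2 = l2Norm f ^ 4 * l2Norm g ^ 4 := by
  rw [integral_norm_crossSchwartz_sq, mul_pow, l2Norm_pow_four, l2Norm_pow_four]

end CrossSignal

section KernelPhase

/-- The part of the phase of `kernel ν A x u` that is due to the signal variable `x` alone. -/
noncomputable def chirpPhase (A : Params) (x : ℝ) : ℝ :=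
  (A.a * x ^ 2 + 2 * x * A.τ) * (1 / (2 * A.b))

/-- The derivative of `chirpPhase A`. -/
noncomputable def chirpPhaseDeriv (A : Params) (x : ℝ) : ℝ :=
  (A.a * x + A.τ) * (1 / A.b)

/-- The part of the phase of `kernel ν A x u` that does not depend on the signal variable `x`. -/
noncomputable def frequencyPhase (A : Params) (u : ℝ) : ℝ :=
  -(SignType.sign A.b : ℝ) * (Real.pi / 4) +
    (-2 * u * (A.d * A.τ - A.b * A.η) + A.d * (u ^ 2 + A.τ ^ 2)) * (1 / (2 * A.b))

/-- The phase of `kernel ν A t u`, including that of the factor `1 / √(ν 2 π b)`. The middle term is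
written as the phase of a Fourier transform at the frequency `u / (2 π b)`. -/
noncomputable def kernelPhase (A : Params) (t u : ℝ) : ℝ :=
  chirpPhase A t - 2 * Real.pi * (t * (u / (2 * Real.pi * A.b))) + frequencyPhase A u

theorem kernel_eq_smul_unitExp_kernelPhase {ν : ℍ[ℝ]} (hν : ν ^ 2 = -1) {A : Params}
    (hb : A.b ≠ 0) (t u : ℝ) :
    kernel ν A t u = (1 / Real.sqrt (2 * Real.pi * |A.b|)) • unitExp ν (kernelPhase A t u) := by
  rw [kernel, kernelConst, mul_assoc, ← unitExp_add hν, Quaternion.coe_mul_eq_smul]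
  congr 2
  unfold kernelPhase chirpPhase frequencyPhase
  field_simp [Real.pi_ne_zero]
  ring

theorem one_div_sqrt_two_pi_mul_abs_sq (b : ℝ) :
    (1 / Real.sqrt (2 * Real.pi * |b|)) ^ 2 = 1 / (2 * Real.pi * |b|) := by
  rw [div_pow, one_pow, Real.sq_sqrt (by positivity)]

theorem hasTemperateGrowth_chirpPhase (A : Params) : (chirpPhase A).HasTemperateGrowth := by
  unfold chirpPhase
  fun_prop

theorem hasTemperateGrowth_chirpPhaseDeriv (A : Params) :
    (chirpPhaseDeriv A).HasTemperateGrowth := by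
  unfold chirpPhaseDeriv
  fun_prop

theorem measurable_kernelPhase (A : Params) (u : ℝ) : Measurable fun t => kernelPhase A t u := by
  unfold kernelPhase chirpPhase
  fun_prop

theorem hasDerivAt_chirpPhase (A : Params) (x : ℝ) :
    HasDerivAt (chirpPhase A) (chirpPhaseDeriv A x) x := by
  refine (((((hasDerivAt_id' x).fun_pow 2).const_mul A.a).fun_add
    (((hasDerivAt_id' x).const_mul 2).mul_const A.τ)).mul_const (1 / (2 * A.b))).congr_deriv ?_
  simp only [chirpPhaseDeriv, one_div, mul_inv]
  ring

end KernelPhase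

section Nondegenerate

variable {ι : Type*} [Fintype ι] {σ : ι → ℝ}

theorem hasTemperateGrowth_euclideanSpace_apply (i : ι) :
    (fun s : EuclideanSpace ℝ ι => s i).HasTemperateGrowth :=
  (EuclideanSpace.proj (𝕜 := ℝ) i).hasTemperateGrowth

theorem hasTemperateGrowth_sum_chirpPhase (A : ι → Params) (σ : ι → ℝ) :
    (fun s : EuclideanSpace ℝ ι => ∑ i, σ i * chirpPhase (A i) (s i)).HasTemperateGrowth :=
  .sum fun i _ => (Function.HasTemperateGrowth.const _).mul
    ((hasTemperateGrowth_chirpPhase (A i)).comp (hasTemperateGrowth_euclideanSpace_apply i))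

theorem hasLineDerivAt_sum_chirpPhase [DecidableEq ι] (A : ι → Params) (σ : ι → ℝ) (k : ι)
    (s : EuclideanSpace ℝ ι) :
    HasLineDerivAt ℝ (fun s : EuclideanSpace ℝ ι => ∑ i, σ i * chirpPhase (A i) (s i))
      (σ k * chirpPhaseDeriv (A k) (s k)) s (EuclideanSpace.single k 1) := by
  have hsum := HasFDerivAt.fun_sum (u := Finset.univ) fun i _ =>
    (((hasDerivAt_chirpPhase (A i) (s i)).comp_hasFDerivAt s
      (EuclideanSpace.proj (𝕜 := ℝ) i).hasFDerivAt).const_mul (σ i))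
  simpa using hsum.hasLineDerivAt (EuclideanSpace.single k 1)

theorem sum_mul_kernelPhase (A : ι → Params) (σ : ι → ℝ) (s ξ : EuclideanSpace ℝ ι) :
    ∑ i, σ i * kernelPhase (A i) (s i) (ξ i)
      = ∑ i, σ i * chirpPhase (A i) (s i)
        - 2 * Real.pi * ⟪s, WithLp.toLp 2 fun i => σ i / (2 * Real.pi * (A i).b) * ξ i⟫
        + ∑ i, σ i * frequencyPhase (A i) (ξ i) := by
  simp only [PiLp.inner_apply, Finset.mul_sum, ← Finset.sum_sub_distrib, ← Finset.sum_add_distrib,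
    kernelPhase, RCLike.inner_apply, conj_trivial]
  exact Finset.sum_congr rfl fun i _ => by ring

theorem chirpEnergy_mul_of_sq_eq_one {D F : Type*} [NormedAddCommGroup D] [NormedSpace ℝ D]
    [NormedAddCommGroup F] [NormedSpace ℝ F] [MeasurableSpace D] {c : ℝ} (hc : c ^ 2 = 1)
    (v : D) (r : D → ℝ) (φ : 𝓢(D, F)) (μ : Measure D) :
    chirpEnergy v (fun x => c * r x) φ μ = chirpEnergy v r φ μ := by
  simp only [chirpEnergy, mul_smul, norm_smul c, mul_pow, Real.norm_eq_abs, sq_abs, hc, one_mul]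

theorem hasBochnerIntegral_sq_mul_norm_integral_cexp_kernelPhase_sq [DecidableEq ι]
    {A : ι → Params} (hb : ∀ i, (A i).b ≠ 0) (hσ : ∀ i, σ i ^ 2 = 1) (k : ι)
    (φ : 𝓢(EuclideanSpace ℝ ι, ℝ)) :
    HasBochnerIntegral (fun ξ : EuclideanSpace ℝ ι => (ξ k / (2 * Real.pi * (A k).b)) ^ 2 *
        ((∏ i, 1 / (2 * Real.pi * |(A i).b|)) *
          ‖∫ s, Complex.exp (↑(∑ i, σ i * kernelPhase (A i) (s i) (ξ i)) * Complex.I) * φ s‖ ^ 2))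
      (1 / (4 * Real.pi ^ 2) *
        chirpEnergy (EuclideanSpace.single k 1) (fun s => chirpPhaseDeriv (A k) (s k)) φ volume)
      volume := by
  have hQ := hasTemperateGrowth_sum_chirpPhase A σ
  have hc (i : ι) : σ i / (2 * Real.pi * (A i).b) ≠ 0 :=
    div_ne_zero (fun h => by simpa [h] using hσ i) (by simp [hb i, Real.pi_ne_zero])
  have habs (i : ι) : |σ i / (2 * Real.pi * (A i).b)| = 1 / (2 * Real.pi * |(A i).b|) := by
    rw [abs_div, abs_mul, abs_of_pos Real.two_pi_pos,
      (pow_eq_one_iff_of_nonneg (abs_nonneg (σ i)) two_ne_zero).1 (by rw [sq_abs, hσ])]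
  have hfourier := (hasBochnerIntegral_inner_sq_mul_norm_fourier_chirp_sq hQ
    (hasLineDerivAt_sum_chirpPhase A σ k) φ).comp_diagonal_add hc 0
  rw [chirpEnergy_mul_of_sq_eq_one (hσ k)] at hfourier
  convert hfourier using 2 with ξ
  simp only [Pi.zero_apply, add_zero, habs, EuclideanSpace.inner_single_right, conj_trivial,
    one_mul, norm_integral_cexp_mul_eq_norm_fourier_chirp hQ φ (sum_mul_kernelPhase A σ · ξ)]
  rw [div_mul_eq_mul_div, mul_div_assoc, mul_pow (σ k), hσ, one_mul, mul_left_comm]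

end Nondegenerate

section RealSignal

variable {lam mu : ℍ[ℝ]} {A : Fin 2 → Params}

theorem norm_qolct_ofReal_sq_of_forall_b_ne_zero (hlam : lam ^ 2 = -1) (hmu : mu ^ 2 = -1)
    (hb : ∀ i, (A i).b ≠ 0) {φ : Plane → ℝ} (hφ : Integrable φ) (ξ : Plane) :
    ‖qolct lam mu A (fun s => (φ s : ℍ[ℝ])) ξ‖ ^ 2
      = (∏ i, 1 / (2 * Real.pi * |(A i).b|)) *
        (‖planePart lam mu 1‖ ^ 2 * ‖∫ s : Plane, Complex.exp (↑(kernelPhase (A 0) (s 0) (ξ 0)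
            + kernelPhase (A 1) (s 1) (ξ 1)) * Complex.I) * φ s‖ ^ 2
          + ‖planePart lam mu (-1)‖ ^ 2 * ‖∫ s : Plane, Complex.exp (↑(kernelPhase (A 0) (s 0) (ξ 0)
            - kernelPhase (A 1) (s 1) (ξ 1)) * Complex.I) * φ s‖ ^ 2) := by
  have hmeas (i : Fin 2) : Measurable fun s : Plane => kernelPhase (A i) (s i) (ξ i) :=
    (measurable_kernelPhase (A i) (ξ i)).comp (by fun_prop)
  simp only [qolct, hb, ne_eq, not_false_eq_true, if_true,
    kernel_eq_smul_unitExp_kernelPhase hlam (hb 0), kernel_eq_smul_unitExp_kernelPhase hmu (hb 1),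
    smul_mul_assoc, mul_smul_comm, integral_smul, norm_smul, mul_pow, Real.norm_eq_abs, sq_abs,
    one_div_sqrt_two_pi_mul_abs_sq, norm_integral_unitExp_mul_mul_unitExp_sq hlam hmu (hmeas 0)
      (hmeas 1) hφ, Fin.prod_univ_two]
  ring

theorem hasBochnerIntegral_qolct_ofReal_of_forall_b_ne_zero (hlam : lam ^ 2 = -1)
    (hmu : mu ^ 2 = -1) (hb : ∀ i, (A i).b ≠ 0) (k : Fin 2) (φ : 𝓢(Plane, ℝ)) :
    HasBochnerIntegral
      (fun ξ : Plane => (ξ k / (2 * Real.pi * (A k).b)) ^ 2 *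
        ‖qolct lam mu A (fun s => (φ s : ℍ[ℝ])) ξ‖ ^ 2)
      (1 / (4 * Real.pi ^ 2) *
        chirpEnergy (EuclideanSpace.single k 1) (fun s => chirpPhaseDeriv (A k) (s k)) φ volume)
      volume := by
  have hphase {ε : ℝ} (hε : ε ^ 2 = 1) :=
    hasBochnerIntegral_sq_mul_norm_integral_cexp_kernelPhase_sq hb (σ := ![1, ε])
      (Fin.forall_fin_two.2 ⟨one_pow 2, hε⟩) k φ
  convert ((hphase (one_pow 2)).const_mul (‖planePart lam mu 1‖ ^ 2)).add
    ((hphase (ε := -1) (by norm_num)).const_mul (‖planePart lam mu (-1)‖ ^ 2)) using 1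
  · funext ξ
    rw [norm_qolct_ofReal_sq_of_forall_b_ne_zero hlam hmu hb φ.integrable]
    simp only [Fin.sum_univ_two, Matrix.cons_val_zero, Matrix.cons_val_one, one_mul, neg_one_mul,
      ← sub_eq_add_neg]
    ring
  · rw [← add_mul, norm_planePart_sq_add hlam hmu, one_mul]

end RealSignal

section Degenerate

theorem norm_integral_kernel_mul_mul_sq {ν : ℍ[ℝ]} (hν : ν ^ 2 = -1) {A : Params} (hb : A.b ≠ 0)
    {φ : ℝ → ℝ} (hφ : Integrable φ) (u : ℝ) (q : ℍ[ℝ]) :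
    ‖∫ x, kernel ν A x u * (φ x : ℍ[ℝ]) * q‖ ^ 2 = 1 / (2 * Real.pi * |A.b|) *
      ‖∫ x, Complex.exp (kernelPhase A x u * Complex.I) * φ x‖ ^ 2 * ‖q‖ ^ 2 := by
  have hphase := norm_integral_mul_unitExp_mul_mul hν (measurable_kernelPhase A u) hφ 1 q
  simp only [one_mul, norm_one] at hphase
  simp only [kernel_eq_smul_unitExp_kernelPhase hν hb, smul_mul_assoc, integral_smul, norm_smul,
    hphase, mul_pow, Real.norm_eq_abs, sq_abs, one_div_sqrt_two_pi_mul_abs_sq]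
  ring

theorem norm_integral_mul_mul_kernel_sq {ν : ℍ[ℝ]} (hν : ν ^ 2 = -1) {A : Params} (hb : A.b ≠ 0)
    {φ : ℝ → ℝ} (hφ : Integrable φ) (u : ℝ) (p : ℍ[ℝ]) :
    ‖∫ x, p * (φ x : ℍ[ℝ]) * kernel ν A x u‖ ^ 2 = 1 / (2 * Real.pi * |A.b|) *
      ‖∫ x, Complex.exp (kernelPhase A x u * Complex.I) * φ x‖ ^ 2 * ‖p‖ ^ 2 := by
  have hcomm (x : ℝ) : unitExp ν (kernelPhase A x u) * (φ x : ℍ[ℝ])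
      = (φ x : ℍ[ℝ]) * unitExp ν (kernelPhase A x u) := (Quaternion.coe_commutes _ _).symm
  have hphase := norm_integral_mul_unitExp_mul_mul hν (measurable_kernelPhase A u) hφ p 1
  simp only [mul_one, norm_one, hcomm, ← mul_assoc] at hphase
  simp only [kernel_eq_smul_unitExp_kernelPhase hν hb, mul_smul_comm, integral_smul, norm_smul,
    hphase, mul_pow, Real.norm_eq_abs, sq_abs, one_div_sqrt_two_pi_mul_abs_sq]
  ring

/-- The splitting `s ↦ (s k.rev, s k)` of the plane, which puts the coordinate `k` last. -/
noncomputable def coordSplit (k : Fin 2) : Plane ≃L[ℝ] ℝ × ℝ :=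
  LinearEquiv.toContinuousLinearEquiv
    { toFun := fun s => (s k.rev, s k)
      map_add' := fun _ _ => rfl
      map_smul' := fun _ _ => rfl
      invFun := fun p => WithLp.toLp 2 fun i => if i = k then p.2 else p.1
      left_inv := fun s => by ext i; fin_cases k <;> fin_cases i <;> rfl
      right_inv := fun p => by fin_cases k <;> rfl }

theorem coordSplit_apply (k : Fin 2) (s : Plane) : coordSplit k s = (s k.rev, s k) := rfl

theorem coordSplit_symm_apply (k : Fin 2) (p : ℝ × ℝ) :
    (coordSplit k).symm p = WithLp.toLp 2 fun i => if i = k then p.2 else p.1 := rfl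

theorem coordSplit_zero_symm_apply (x y : ℝ) : (coordSplit 0).symm (y, x) = !₂[x, y] := by
  ext i
  fin_cases i <;> rfl

theorem coordSplit_one_symm_apply (x y : ℝ) : (coordSplit 1).symm (x, y) = !₂[x, y] := by
  ext i
  fin_cases i <;> rfl

theorem coordSplit_single (k : Fin 2) : coordSplit k (EuclideanSpace.single k 1) = (0, 1) := by
  fin_cases k <;> simp [coordSplit_apply]

theorem measurePreserving_coordSplit (k : Fin 2) :
    MeasurePreserving (coordSplit k) volume (volume.prod volume) := by
  have hpair : MeasurePreserving (fun s : Plane => (s 0, s 1)) volume (volume.prod volume) :=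
    (volume_preserving_finTwoArrow ℝ).comp (PiLp.volume_preserving_ofLp (Fin 2))
  fin_cases k
  · exact Measure.measurePreserving_swap.comp hpair
  · exact hpair

theorem chirpEnergy_compCLMOfContinuousLinearEquiv {D D' F : Type*} [NormedAddCommGroup D]
    [NormedSpace ℝ D] [NormedAddCommGroup D'] [NormedSpace ℝ D'] [NormedAddCommGroup F]
    [NormedSpace ℝ F] [MeasurableSpace D] [BorelSpace D] [MeasurableSpace D'] [BorelSpace D']
    {μ : Measure D} {μ' : Measure D'} {e : D ≃L[ℝ] D'} (he : MeasurePreserving e μ μ') (v : D)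
    (r : D' → ℝ) (φ : 𝓢(D', F)) :
    chirpEnergy v (fun x => r (e x)) (SchwartzMap.compCLMOfContinuousLinearEquiv ℝ e φ) μ
      = chirpEnergy (e v) r φ μ' := by
  have hderiv (x : D) :
      ∂_{v} (SchwartzMap.compCLMOfContinuousLinearEquiv ℝ e φ) x = ∂_{e v} φ (e x) := by
    simp [SchwartzMap.lineDerivOp_apply, lineDeriv]
  simp only [chirpEnergy, hderiv, SchwartzMap.compCLMOfContinuousLinearEquiv_apply,
    Function.comp_apply]
  exact he.integral_comp e.toHomeomorph.measurableEmbedding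
    fun y => ‖∂_{e v} φ y‖ ^ 2 + ‖r y • φ y‖ ^ 2

theorem chirpEnergy_coordSplit_symm {F : Type*} [NormedAddCommGroup F] [NormedSpace ℝ F]
    (k : Fin 2) (r : ℝ → ℝ) (φ : 𝓢(Plane, F)) :
    chirpEnergy (0, 1) (fun p : ℝ × ℝ => r p.2)
        (SchwartzMap.compCLMOfContinuousLinearEquiv ℝ (coordSplit k).symm φ)
        (volume.prod volume)
      = chirpEnergy (EuclideanSpace.single k 1) (fun s => r (s k)) φ volume := by
  have hsnd (p : ℝ × ℝ) : (coordSplit k).symm p k = p.2 := by simp [coordSplit_symm_apply]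
  rw [← (coordSplit k).symm_apply_apply (EuclideanSpace.single k 1), coordSplit_single,
    ← chirpEnergy_compCLMOfContinuousLinearEquiv (e := (coordSplit k).symm)
      ((measurePreserving_coordSplit k).symm (coordSplit k).toHomeomorph.toMeasurableEquiv)]
  simp only [hsnd]

theorem norm_integral_cexp_kernelPhase_eq_norm_fourier_chirp (A : Params) (φ : 𝓢(ℝ, ℝ)) (u : ℝ) :
    ‖∫ x, Complex.exp (kernelPhase A x u * Complex.I) * φ x‖
      = ‖𝓕 (chirp (chirpPhase A) φ : ℝ → ℂ) (u / (2 * Real.pi * A.b))‖ :=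
  norm_integral_cexp_mul_eq_norm_fourier_chirp (hasTemperateGrowth_chirpPhase A) φ
    (c := frequencyPhase A u) fun x => by simp [kernelPhase, mul_comm]

variable {lam mu : ℍ[ℝ]} {A : Fin 2 → Params} {k : Fin 2}

theorem norm_qolct_ofReal_sq_of_rev_b_eq_zero (hlam : lam ^ 2 = -1) (hmu : mu ^ 2 = -1)
    (hb : (A k).b ≠ 0) (hb' : (A k.rev).b = 0) (φ : 𝓢(Plane, ℝ)) (ξ : Plane) :
    ‖qolct lam mu A (fun s => (φ s : ℍ[ℝ])) ξ‖ ^ 2 = 1 / (2 * Real.pi * |(A k).b|) *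
      ‖𝓕 (chirp (chirpPhase (A k))
          (slice (SchwartzMap.compCLMOfContinuousLinearEquiv ℝ (coordSplit k).symm φ)
            ((A k.rev).d * (ξ k.rev - (A k.rev).τ))) : ℝ → ℂ)
          (ξ k / (2 * Real.pi * (A k).b))‖ ^ 2 * |(A k.rev).d| := by
  rw [← norm_integral_cexp_kernelPhase_eq_norm_fourier_chirp]
  set φ' := slice (SchwartzMap.compCLMOfContinuousLinearEquiv ℝ (coordSplit k).symm φ)
    ((A k.rev).d * (ξ k.rev - (A k.rev).τ)) with hφ'
  have happly (x : ℝ) :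
      φ' x = φ ((coordSplit k).symm ((A k.rev).d * (ξ k.rev - (A k.rev).τ), x)) := rfl
  fin_cases k
  · change (A 0).b ≠ 0 at hb
    change (A 1).b = 0 at hb'
    have hkernel := norm_integral_kernel_mul_mul_sq hlam hb φ'.integrable (ξ 0)
      (degenerateFactor mu (A 1) (ξ 1))
    simpa [qolct, hb, hb', happly, coordSplit_zero_symm_apply, norm_degenerateFactor_sq hmu]
      using hkernel
  · change (A 1).b ≠ 0 at hb
    change (A 0).b = 0 at hb'
    have hkernel := norm_integral_mul_mul_kernel_sq hmu hb φ'.integrable (ξ 1)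
      (degenerateFactor lam (A 0) (ξ 0))
    simpa [qolct, hb, hb', happly, coordSplit_one_symm_apply, norm_degenerateFactor_sq hlam]
      using hkernel

theorem hasBochnerIntegral_qolct_ofReal_of_rev_b_eq_zero (hlam : lam ^ 2 = -1)
    (hmu : mu ^ 2 = -1) (hb : (A k).b ≠ 0) (hb' : (A k.rev).b = 0) (φ : 𝓢(Plane, ℝ)) :
    HasBochnerIntegral
      (fun ξ : Plane => (ξ k / (2 * Real.pi * (A k).b)) ^ 2 *
        ‖qolct lam mu A (fun s => (φ s : ℍ[ℝ])) ξ‖ ^ 2)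
      (1 / (4 * Real.pi ^ 2) *
        chirpEnergy (EuclideanSpace.single k 1) (fun s => chirpPhaseDeriv (A k) (s k)) φ volume)
      volume := by
  have hd : (A k.rev).d ≠ 0 := fun hd => by simpa [hb', hd] using (A k.rev).det_eq_one
  have hQr (x : ℝ) : HasLineDerivAt ℝ (chirpPhase (A k)) (chirpPhaseDeriv (A k) x) x 1 := by
    simpa using (hasDerivAt_chirpPhase (A k) x).hasFDerivAt.hasLineDerivAt 1
  have hslice := (hasBochnerIntegral_inner_sq_mul_norm_fourier_chirp_slice_sq
    (SchwartzMap.compCLMOfContinuousLinearEquiv ℝ (coordSplit k).symm φ)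
    (hasTemperateGrowth_chirpPhase (A k)) (hasTemperateGrowth_chirpPhaseDeriv (A k)) hQr
    volume).comp_measurePreserving (measurePreserving_coordSplit k)
      (coordSplit k).toHomeomorph.measurableEmbedding
  rw [chirpEnergy_coordSplit_symm] at hslice
  let c (i : Fin 2) : ℝ := if i = k then 1 / (2 * Real.pi * (A k).b) else (A k.rev).d
  let e (i : Fin 2) : ℝ := if i = k then 0 else -((A k.rev).d * (A k.rev).τ)
  have hc (i : Fin 2) : c i ≠ 0 := by
    unfold c
    split_ifs
    exacts [by simp [hb, Real.pi_ne_zero], hd]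
  have hprod : ∏ i, |c i| = 1 / (2 * Real.pi * |(A k).b|) * |(A k.rev).d| := by
    fin_cases k <;> simp [c, abs_mul, abs_of_pos Real.pi_pos, mul_comm]
  have hsplit (ξ : Plane) : coordSplit k (WithLp.toLp 2 fun i => c i * ξ i + e i)
      = ((A k.rev).d * (ξ k.rev - (A k.rev).τ), ξ k / (2 * Real.pi * (A k).b)) := by
    have hrev : k.rev ≠ k := by fin_cases k <;> decide
    simp only [coordSplit_apply, c, e, hrev, if_true, if_false]
    congr 1 <;> ring
  convert hslice.comp_diagonal_add hc e using 2 with ξ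
  rw [norm_qolct_ofReal_sq_of_rev_b_eq_zero hlam hmu hb hb', hprod, hsplit, RCLike.inner_apply,
    conj_trivial, one_mul]
  ring

end Degenerate

section Components

/-- `component m` as a continuous linear map. -/
noncomputable def componentCLM (m : Fin 4) : ℍ[ℝ] →L[ℝ] ℝ :=
  LinearMap.toContinuousLinearMap
    { toFun := component m
      map_add' := fun p q => by fin_cases m <;> simp [component]
      map_smul' := fun c p => by fin_cases m <;> simp [component] }

theorem sum_componentCLM_sq (q : ℍ[ℝ]) : ∑ m : Fin 4, componentCLM m q ^ 2 = ‖q‖ ^ 2 := by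
  rw [sq, ← Quaternion.normSq_eq_norm_mul_self, Quaternion.normSq_def', Fin.sum_univ_four]
  rfl

theorem lineDerivOp_postcompCLM {D F G : Type*} [NormedAddCommGroup D] [NormedSpace ℝ D]
    [NormedAddCommGroup F] [NormedSpace ℝ F] [NormedAddCommGroup G] [NormedSpace ℝ G]
    (L : F →L[ℝ] G) (φ : 𝓢(D, F)) (v x : D) :
    ∂_{v} (SchwartzMap.postcompCLM (𝕜 := ℝ) L φ) x = L (∂_{v} φ x) := by
  simp only [SchwartzMap.lineDerivOp_apply_eq_fderiv]
  exact DFunLike.congr_fun (L.hasFDerivAt.comp x (φ.hasFDerivAt x)).fderiv v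

theorem sum_chirpEnergy_component {D : Type*} [NormedAddCommGroup D] [NormedSpace ℝ D]
    [FiniteDimensional ℝ D] [MeasurableSpace D] [BorelSpace D] (v : D) {r : D → ℝ}
    (hr : r.HasTemperateGrowth) (h : 𝓢(D, ℍ[ℝ])) (μ : Measure D) [μ.IsAddHaarMeasure] :
    ∑ m : Fin 4, chirpEnergy v r (SchwartzMap.postcompCLM (𝕜 := ℝ) (componentCLM m) h) μ
      = chirpEnergy v r h μ := by
  have hsum := HasBochnerIntegral.sum fun m (_ : m ∈ Finset.univ) =>
    hasBochnerIntegral_chirpEnergy v hr (SchwartzMap.postcompCLM (𝕜 := ℝ) (componentCLM m) h) μ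
  rw [← hsum.2]
  simp only [chirpEnergy, lineDerivOp_postcompCLM, SchwartzMap.postcompCLM_apply,
    norm_smul, mul_pow, Real.norm_eq_abs, sq_abs, Finset.sum_add_distrib,
    ← Finset.mul_sum, sum_componentCLM_sq]

variable {lam mu : ℍ[ℝ]} {A : Fin 2 → Params} {k : Fin 2}

theorem hasBochnerIntegral_qolct_ofReal (hlam : lam ^ 2 = -1) (hmu : mu ^ 2 = -1)
    (hb : (A k).b ≠ 0) (φ : 𝓢(Plane, ℝ)) :
    HasBochnerIntegral
      (fun ξ : Plane => (ξ k / (2 * Real.pi * (A k).b)) ^ 2 *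
        ‖qolct lam mu A (fun s => (φ s : ℍ[ℝ])) ξ‖ ^ 2)
      (1 / (4 * Real.pi ^ 2) *
        chirpEnergy (EuclideanSpace.single k 1) (fun s => chirpPhaseDeriv (A k) (s k)) φ volume)
      volume := by
  by_cases hb' : (A k.rev).b = 0
  · exact hasBochnerIntegral_qolct_ofReal_of_rev_b_eq_zero hlam hmu hb hb' φ
  · refine hasBochnerIntegral_qolct_ofReal_of_forall_b_ne_zero hlam hmu
      (Fin.forall_fin_two.2 ?_) k φ
    fin_cases k
    exacts [⟨hb, hb'⟩, ⟨hb', hb⟩]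

theorem integral_sq_mul_transformModulus (hlam : lam ^ 2 = -1) (hmu : mu ^ 2 = -1)
    (hb : (A k).b ≠ 0) (h : 𝓢(Plane, ℍ[ℝ])) :
    ∫ ξ : Plane, (ξ k / (2 * Real.pi * (A k).b) * transformModulus (qolct lam mu A) h ξ) ^ 2
      = 1 / (4 * Real.pi ^ 2) *
        chirpEnergy (EuclideanSpace.single k 1) (fun s => chirpPhaseDeriv (A k) (s k)) h
          volume := by
  have hr : (fun s : Plane => chirpPhaseDeriv (A k) (s k)).HasTemperateGrowth :=
    (hasTemperateGrowth_chirpPhaseDeriv (A k)).comp (hasTemperateGrowth_euclideanSpace_apply k)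
  have hsum := HasBochnerIntegral.sum fun m (_ : m ∈ Finset.univ) =>
    hasBochnerIntegral_qolct_ofReal hlam hmu hb
      (SchwartzMap.postcompCLM (𝕜 := ℝ) (componentCLM m) h)
  rw [← sum_chirpEnergy_component _ hr h, Finset.mul_sum, ← hsum.2]
  simp only [mul_pow, transformModulus, Real.sq_sqrt (Finset.sum_nonneg fun _ _ => sq_nonneg _),
    Finset.mul_sum]
  rfl

end Components

theorem heisenberg_inequality_slice {D E F : Type*} [NormedAddCommGroup D]
    [NormedSpace ℝ D] [FiniteDimensional ℝ D] [MeasurableSpace D] [BorelSpace D]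
    [NormedAddCommGroup E] [NormedSpace ℝ E] [FiniteDimensional ℝ E] [MeasurableSpace E]
    [BorelSpace E] [NormedAddCommGroup F] [InnerProductSpace ℝ F] (L : E →L[ℝ] ℝ) (v : E)
    {r : E → ℝ} (hr : r.HasTemperateGrowth) (Φ : 𝓢(D × E, F)) (μ : Measure D)
    [μ.IsAddHaarMeasure] (ν : Measure E) [ν.IsAddHaarMeasure] :
    L v ^ 2 * (∫ p, ‖Φ p‖ ^ 2 ∂(μ.prod ν)) ^ 2 ≤
      4 * ((∫ x, ∫ y, ‖L y • slice Φ x y‖ ^ 2 ∂ν ∂μ) * ∫ x, chirpEnergy v r (slice Φ x) ν ∂μ) := by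
  let snd := ContinuousLinearMap.snd ℝ D E
  have hposition : ∫ x, ∫ y, ‖L y • slice Φ x y‖ ^ 2 ∂ν ∂μ
      = ∫ p, ‖(L ∘L snd) p • Φ p‖ ^ 2 ∂(μ.prod ν) :=
    (integral_prod _ (integrable_norm_smul_sq Φ (L ∘L snd).hasTemperateGrowth _)).symm
  rw [hposition, (hasBochnerIntegral_chirpEnergy_slice Φ v hr μ ν).2]
  calc
    _ ≤ 4 * ((∫ p, ‖(L ∘L snd) p • Φ p‖ ^ 2 ∂(μ.prod ν)) *
          ∫ p, ‖∂_{((0 : D), v)} Φ p‖ ^ 2 ∂(μ.prod ν)) :=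
      heisenberg_inequality (L ∘L snd) (0, v) Φ (μ.prod ν)
    _ ≤ _ := by
      gcongr
      exact integral_norm_lineDerivOp_sq_le_chirpEnergy (0, v) (hr.comp snd.hasTemperateGrowth) Φ _

end QOLCT

open QOLCT in
theorem mainTheorem3 (lam mu : ℍ[ℝ]) (hlam : lam ^ 2 = -1) (hmu : mu ^ 2 = -1)
    (A : Fin 2 → QOLCT.Params) (f g : 𝓢(QOLCT.Plane, ℍ[ℝ])) (k : Fin 2) (hb : (A k).b ≠ 0) :
    (∫ t : QOLCT.Plane, ∫ s : QOLCT.Plane, ‖(s k) • QOLCT.crossSignal f g t s‖ ^ 2) *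
      (∫ t : QOLCT.Plane, ∫ ξ : QOLCT.Plane,
        ((ξ k / (2 * Real.pi * (A k).b)) * QOLCT.wvdModulus lam mu A f g t ξ) ^ 2) ≥
      1 / (16 * Real.pi ^ 2) * QOLCT.l2Norm f ^ 4 * QOLCT.l2Norm g ^ 4 := by
  have hr : (fun s : Plane => chirpPhaseDeriv (A k) (s k)).HasTemperateGrowth :=
    (hasTemperateGrowth_chirpPhaseDeriv (A k)).comp (hasTemperateGrowth_euclideanSpace_apply k)
  have hheisenberg := heisenberg_inequality_slice (EuclideanSpace.proj k)
    (EuclideanSpace.single k 1) hr (crossSchwartz f g) volume volume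
  simp only [PiLp.proj_apply, PiLp.single_eq_same, one_pow, one_mul,
    sq_integral_norm_crossSchwartz_sq] at hheisenberg
  simp only [wvdModulus, ← coe_slice_crossSchwartz, integral_sq_mul_transformModulus hlam hmu hb,
    integral_const_mul]
  calc
    _ = 1 / (16 * Real.pi ^ 2) * (l2Norm f ^ 4 * l2Norm g ^ 4) := mul_assoc _ _ _
    _ ≤ 1 / (16 * Real.pi ^ 2) * _ := mul_le_mul_of_nonneg_left hheisenberg (by positivity)
    _ = _ := by ring
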